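/- A continuum is a compact connected (in particular non-empty) Hausdorff space; it is non-degenerate if it has more than one point. A continuum is Suslinian if every family of pairwise disjoint non-degenerate subcontinua of it is countable. A non-degenerate continuum is decomposable if it is the union of two proper non-degenerate subcontinua, and a continuum is hereditarily decomposable if all of its non-degenerate subcontinua are decomposable. For a continuum $Y$ let $$\mathrm{Sln}(Y)=\sup\{|\mathcal C| : \mathcal C \text{ is a family of pairwise disjoint non-degenerate subcontinua of } Y\},$$ and for a Tychonoff space $X$ let $\mathrm{Sln}(X)$ be the minimum of $\mathrm{Sln}(Y)$ over all continua $Y$ that contain a homeomorphic copy of $X$ (for continua the two definitions agree). Proposition. Let $X$ be a Tychonoff space with $\mathrm{Sln}(X)\le\aleph_0$. Then every compact zero-dimensional subspace of $X$ is metrizable, and every non-degenerate subcontinuum of $X$ is decomposable. In particular, every Suslinian continuum is hereditarily decomposable. -/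

import Mathlib

open Set Topology Cardinal

universe u

/-- A subcontinuum of a Hausdorff space: a compact connected (in particular non-empty) subset. -/
structure IsSubcontinuum {X : Type u} [TopologicalSpace X] (C : Set X) : Prop where
  isCompact : IsCompact C
  isConnected : IsConnected C

/-- A disjoint family of non-degenerate subcontinua of `X`
(non-degenerate means having more than one point). -/
structure IsDisjointContinuumFamily {X : Type u} [TopologicalSpace X] (𝒞 : Set (Set X)) :
    Prop where
  isSubcontinuum : ∀ C ∈ 𝒞, IsSubcontinuum C
  nontrivial : ∀ C ∈ 𝒞, C.Nontrivial
  pairwiseDisjoint : 𝒞.PairwiseDisjoint id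

/-- The Suslinian number of a continuum `Y`: the supremum of the cardinalities of
disjoint families of non-degenerate subcontinua of `Y`. -/
noncomputable def continuumSln (Y : Type u) [TopologicalSpace Y] : Cardinal.{u} :=
  ⨆ 𝒞 : {𝒞 : Set (Set Y) // IsDisjointContinuumFamily 𝒞}, #𝒞.1

/-- The Suslinian number of a Tychonoff space `X`: the least Suslinian number of a continuum
(a compact connected Hausdorff space) `Y` that contains `X` topologically. -/
noncomputable def Sln (X : Type u) [TopologicalSpace X] : Cardinal.{u} :=
  sInf {κ : Cardinal.{u} | ∃ (Y : Type u) (_ : TopologicalSpace Y),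
    CompactSpace Y ∧ T2Space Y ∧ ConnectedSpace Y ∧
    (∃ e : X → Y, IsEmbedding e) ∧ κ = continuumSln Y}

/-- A continuum is Suslinian if every disjoint family of its non-degenerate subcontinua
is countable. -/
def IsSuslinian (X : Type u) [TopologicalSpace X] : Prop :=
  ∀ 𝒞 : Set (Set X), IsDisjointContinuumFamily 𝒞 → 𝒞.Countable

/-- A subcontinuum `C` is decomposable if it is the union of two proper non-degenerate
subcontinua. -/
def IsDecomposable {X : Type u} [TopologicalSpace X] (C : Set X) : Prop :=
  ∃ A B : Set X, IsSubcontinuum A ∧ IsSubcontinuum B ∧ A.Nontrivial ∧ B.Nontrivial ∧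
    A ⊂ C ∧ B ⊂ C ∧ A ∪ B = C

/-- A continuum is hereditarily decomposable if each of its non-degenerate subcontinua is
decomposable. -/
def IsHereditarilyDecomposable (X : Type u) [TopologicalSpace X] : Prop :=
  ∀ C : Set X, IsSubcontinuum C → C.Nontrivial → IsDecomposable C

/-! The infimum `Sln X` is attained, so `X` embeds in a Suslinian continuum `Y`. Everything rests on
boundary bumping: components of a closed set at interior points are non-degenerate, hence countably
many in `Y`.

Decomposability: off a small open set such components cover a non-empty open set. By Baire one of
them has interior, and a proper subcontinuum with interior yields a decomposition.

Metrizability: a maximal disjoint family of non-degenerate continua missing `Z` is countable, so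
some continuous `g ≥ 0` vanishes on `Z` and is positive on the family. By maximality `{g = 0}`
contains no non-degenerate continuum. Components of the sets `{g ≤ 1 / (n + 1)}` then separate the
points of `Z`, and countably many Urysohn functions embed `Z` in a metrizable product. -/

section Continua

variable {Y : Type u} [TopologicalSpace Y]

/-! ### Boundary bumping and components -/

/-- Boundary bumping: a component of a closed set `K` does not fit inside an open subset of `K`
unless that open subset is everything. -/
theorem eq_univ_of_connectedComponentIn_subset [CompactSpace Y] [T2Space Y] [ConnectedSpace Y]
    {K U : Set Y} (hK : IsClosed K) (hU : IsOpen U) (hUK : U ⊆ K) {x : Y} (hx : x ∈ K)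
    (h : connectedComponentIn K x ⊆ U) : U = Set.univ := by
  have : CompactSpace K := isCompact_iff_compactSpace.1 hK.isCompact
  have hsub : connectedComponent (⟨x, hx⟩ : K) ⊆ ((↑) ⁻¹' U : Set K) := by
    rw [connectedComponentIn_eq_image hx] at h
    exact image_subset_iff.1 h
  rw [connectedComponent_eq_iInter_isClopen] at hsub
  have : Nonempty { s : Set K // IsClopen s ∧ (⟨x, hx⟩ : K) ∈ s } :=
    ⟨⟨Set.univ, isClopen_univ, mem_univ _⟩⟩
  -- Compactness puts one clopen `Q` of `K` inside `U`; as `U` is open in `Y`, so is `Q`.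
  obtain ⟨⟨Q, hQ, hxQ⟩, hQU⟩ := exists_subset_nhds_of_isCompact'
    (V := fun s : { s : Set K // IsClopen s ∧ (⟨x, hx⟩ : K) ∈ s } => s.1)
    (by
      rintro ⟨s, hs, hxs⟩ ⟨t, ht, hxt⟩
      exact ⟨⟨s ∩ t, hs.inter ht, hxs, hxt⟩, inter_subset_left, inter_subset_right⟩)
    (fun s => s.2.1.isClosed.isCompact) (fun s => s.2.1.isClosed)
    (U := ((↑) ⁻¹' U : Set K))
    (fun y hy => (hU.preimage continuous_subtype_val).mem_nhds (hsub hy))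
  have hcl : IsClosed ((↑) '' Q : Set Y) := hK.isClosedMap_subtype_val _ hQ.isClosed
  have hop : IsOpen ((↑) '' Q : Set Y) := by
    obtain ⟨W, hW, rfl⟩ := isOpen_induced_iff.1 hQ.isOpen
    have : ((↑) '' ((↑) ⁻¹' W : Set K) : Set Y) = W ∩ U := by
      ext y
      constructor
      · rintro ⟨z, hz, rfl⟩
        exact ⟨hz, hQU hz⟩
      · rintro ⟨hy, hyU⟩
        exact ⟨⟨y, hUK hyU⟩, hy, rfl⟩
    rw [this]
    exact hW.inter hU
  have huniv : ((↑) '' Q : Set Y) = Set.univ :=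
    IsClopen.eq_univ ⟨hcl, hop⟩ ⟨x, ⟨x, hx⟩, hxQ, rfl⟩
  exact univ_subset_iff.1 (huniv ▸ image_subset_iff.2 hQU)

theorem isSubcontinuum_connectedComponentIn [CompactSpace Y] {K : Set Y} (hK : IsClosed K)
    {x : Y} (hx : x ∈ K) : IsSubcontinuum (connectedComponentIn K x) := by
  refine ⟨IsClosed.isCompact ?_, isConnected_connectedComponentIn_iff.2 hx⟩
  rw [connectedComponentIn_eq_image hx]
  exact hK.isClosedMap_subtype_val _ isClosed_connectedComponent

theorem connectedComponentIn_nontrivial_of_ne_univ [CompactSpace Y] [T2Space Y]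
    [ConnectedSpace Y] {K U : Set Y} (hK : IsClosed K) (hU : IsOpen U) (hUK : U ⊆ K)
    (hne : U ≠ Set.univ) {x : Y} (hx : x ∈ U) : (connectedComponentIn K x).Nontrivial := by
  obtain ⟨y, hy, hyU⟩ := not_subset.1
    (mt (eq_univ_of_connectedComponentIn_subset hK hU hUK (hUK hx)) hne)
  exact ⟨x, mem_connectedComponentIn (hUK hx), y, hy, fun h => hyU (h ▸ hx)⟩

/-- The non-degenerate components of a set in a Suslinian space form a countable family. -/
theorem IsSuslinian.countable_components [CompactSpace Y] (hY : IsSuslinian Y) {K : Set Y}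
    (hK : IsClosed K) :
    {C : Set Y | C.Nontrivial ∧ ∃ x ∈ K, C = connectedComponentIn K x}.Countable := by
  refine hY _ ⟨?_, fun C hC => hC.1, ?_⟩
  · rintro C ⟨-, x, hx, rfl⟩
    exact isSubcontinuum_connectedComponentIn hK hx
  · rintro C ⟨-, x, hx, rfl⟩ D ⟨-, y, hy, rfl⟩ hne
    refine disjoint_left.2 fun z hz hz' => hne ?_
    rw [connectedComponentIn_eq hz, connectedComponentIn_eq hz']

theorem IsSubcontinuum.image {Z : Type u} [TopologicalSpace Z] {C : Set Y}
    (hC : IsSubcontinuum C) {f : Y → Z} (hf : Continuous f) : IsSubcontinuum (f '' C) :=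
  ⟨hC.isCompact.image hf, hC.isConnected.image f hf.continuousOn⟩

/-- Lets a subcontinuum be treated as a whole space. -/
theorem IsSuslinian.of_injective {Z : Type u} [TopologicalSpace Z] (hZ : IsSuslinian Z)
    {f : Y → Z} (hf : Continuous f) (hinj : Function.Injective f) : IsSuslinian Y := by
  intro 𝒞 h𝒞
  refine Set.countable_of_injective_of_countable_image (f := fun C => f '' C)
    (hinj.image_injective.injOn) (hZ _ ⟨?_, ?_, ?_⟩)
  · rintro _ ⟨C, hC, rfl⟩
    exact (h𝒞.isSubcontinuum C hC).image hf
  · rintro _ ⟨C, hC, rfl⟩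
    exact (h𝒞.nontrivial C hC).image hinj
  · rintro _ ⟨C, hC, rfl⟩ _ ⟨D, hD, rfl⟩ hne
    exact (disjoint_image_iff hinj).2 (h𝒞.pairwiseDisjoint hC hD fun h => hne (h ▸ rfl))

/-! ### Decomposability -/

/-- A proper subcontinuum with non-empty interior in a non-degenerate continuum yields a
decomposition. -/
theorem isDecomposable_univ_of_interior_nonempty [CompactSpace Y] [T2Space Y] [ConnectedSpace Y]
    [Nontrivial Y] {P : Set Y} (hP : IsSubcontinuum P) (hne : P ≠ Set.univ)
    (hint : (interior P).Nonempty) : IsDecomposable (Set.univ : Set Y) := by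
  have hntr : ∀ {S W : Set Y}, IsOpen W → W.Nonempty → W ⊆ S → S.Nontrivial := by
    intro S W hW hWne hWS
    by_contra hcon
    rw [not_nontrivial_iff] at hcon
    have hWs : W.Subsingleton := hcon.anti hWS
    have : W = Set.univ := IsClopen.eq_univ ⟨hWs.finite.isClosed, hW⟩ hWne
    exact nontrivial_univ.not_subsingleton (this ▸ hWs)
  have hPc : IsClosed P := hP.isCompact.isClosed
  have hcne : (Pᶜ).Nonempty := nonempty_compl.2 hne
  have hPnt : P.Nontrivial := hntr isOpen_interior hint interior_subset
  by_cases hconn : IsPreconnected Pᶜ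
  · refine ⟨P, closure Pᶜ, hP, ⟨isClosed_closure.isCompact, hcne.closure, hconn.closure⟩, hPnt,
      hntr hPc.isOpen_compl hcne subset_closure, ssubset_univ_iff.2 hne, ssubset_univ_iff.2 ?_, ?_⟩
    · rw [closure_compl, Ne, compl_univ_iff]
      exact hint.ne_empty
    · exact univ_subset_iff.1 (by
        rw [← union_compl_self P]
        exact union_subset_union_right _ subset_closure)
  · obtain ⟨A, B, hA, hB, hsub, hAn, hBn, hAB⟩ : ∃ A B : Set Y, IsOpen A ∧ IsOpen B ∧
        Pᶜ = A ∪ B ∧ A.Nonempty ∧ B.Nonempty ∧ Disjoint A B := by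
      simp only [IsPreconnected, not_forall, not_nonempty_iff_eq_empty] at hconn
      obtain ⟨u, v, hu, hv, huv, hun, hvn, he⟩ := hconn
      refine ⟨Pᶜ ∩ u, Pᶜ ∩ v, hPc.isOpen_compl.inter hu, hPc.isOpen_compl.inter hv, ?_, hun, hvn,
        ?_⟩
      · rw [← inter_union_distrib_left, inter_eq_left.2 huv]
      · rw [disjoint_iff_inter_eq_empty, ← inter_inter_distrib_left, he]
    have key : ∀ {A B : Set Y}, IsOpen A → IsOpen B → Pᶜ = A ∪ B → Disjoint A B →
        IsSubcontinuum (P ∪ A) := by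
      intro A B hA hB hsub hAB
      have hPA : P ∪ A = Bᶜ := by
        ext y
        have h1 : y ∉ P ↔ y ∈ A ∨ y ∈ B := by
          rw [← mem_compl_iff, hsub, mem_union]
        have h2 : y ∈ A → y ∉ B := fun h => disjoint_left.1 hAB h
        simp only [mem_union, mem_compl_iff]
        tauto
      have hcl : IsClosed (P ∪ A) := hPA ▸ hB.isClosed_compl
      refine ⟨hcl.isCompact, hP.isConnected.nonempty.inl, ?_⟩
      rw [isPreconnected_iff_subset_of_disjoint_closed]
      have aux : ∀ u v : Set Y, IsClosed u → IsClosed v → P ∪ A ⊆ u ∪ v →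
          (P ∪ A) ∩ (u ∩ v) = ∅ → P ⊆ u → P ∪ A ⊆ u := by
        intro u v hu hv huv he hPu
        -- This equality makes the part in `v` both closed and open in `Y`, hence empty, since `P`
        -- lies in `u`.
        have hset : (P ∪ A) ∩ v = A ∩ uᶜ := by
          ext y
          have h1 := @huv y
          have h2 : ¬ (y ∈ (P ∪ A) ∩ (u ∩ v)) := by simp [he]
          have h3 := @hPu y
          simp only [mem_inter_iff, mem_union, mem_compl_iff] at *
          tauto
        have hclop : IsClopen ((P ∪ A) ∩ v) := ⟨hcl.inter hv, hset ▸ hA.inter hu.isOpen_compl⟩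
        rcases isClopen_iff.1 hclop with h | h
        · intro y hy
          rcases huv hy with hyu | hyv
          · exact hyu
          · exact absurd (show y ∈ (P ∪ A) ∩ v from ⟨hy, hyv⟩) (by simp [h])
        · obtain ⟨p, hp⟩ := hP.isConnected.nonempty
          have : p ∈ A ∩ uᶜ := hset ▸ h ▸ mem_univ p
          exact absurd (hPu hp) this.2
      intro u v hu hv huv he
      have hPsub := isPreconnected_iff_subset_of_disjoint_closed.1 hP.isConnected.isPreconnected
        u v hu hv (subset_union_left.trans huv)
        (subset_empty_iff.1 (he ▸ inter_subset_inter_left _ subset_union_left))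
      rcases hPsub with h | h
      · exact Or.inl (aux u v hu hv huv he h)
      · exact Or.inr (aux v u hv hu (union_comm u v ▸ huv) (inter_comm u v ▸ he) h)
    have hdisj : ∀ {A B : Set Y}, Pᶜ = A ∪ B → Disjoint A B → B.Nonempty →
        P ∪ A ⊂ Set.univ := by
      rintro A B hsub hAB ⟨b, hb⟩
      refine ssubset_univ_iff.2 fun h => ?_
      rcases (h ▸ mem_univ b : b ∈ P ∪ A) with hbP | hbA
      · exact (hsub ▸ Or.inr hb : b ∈ Pᶜ) hbP
      · exact disjoint_left.1 hAB hbA hb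
    have hsub' := hsub.trans (union_comm A B)
    refine ⟨P ∪ A, P ∪ B, key hA hB hsub hAB, key hB hA hsub' hAB.symm,
      hPnt.mono subset_union_left, hPnt.mono subset_union_left, hdisj hsub hAB hBn,
      hdisj hsub' hAB.symm hAn, ?_⟩
    rw [← union_union_distrib_left, ← hsub, union_compl_self]

theorem IsSuslinian.isDecomposable_univ [CompactSpace Y] [T2Space Y] [ConnectedSpace Y]
    [Nontrivial Y] (hY : IsSuslinian Y) : IsDecomposable (Set.univ : Set Y) := by
  by_contra hdec
  obtain ⟨a, b, hab⟩ := exists_pair_ne Y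
  obtain ⟨U, V, haU, hU, hbV, hV, hUV⟩ : ∃ U V : Set Y, a ∈ U ∧ IsOpen U ∧ b ∈ V ∧ IsOpen V ∧
      Disjoint (closure U) (closure V) := by
    obtain ⟨U, haU, hU, V, hbV, hV, h⟩ := exists_open_nhds_disjoint_closure hab
    exact ⟨U, V, haU, hU, hbV, hV, h⟩
  have hK : IsClosed Uᶜ := hU.isClosed_compl
  have hWK : (closure U)ᶜ ⊆ Uᶜ := compl_subset_compl.2 subset_closure
  have hWne : (closure U)ᶜ ≠ Set.univ := by
    rw [Ne, compl_univ_iff]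
    exact (Set.Nonempty.closure ⟨a, haU⟩).ne_empty
  have hVW : V ⊆ (closure U)ᶜ := fun y hy hyU =>
    disjoint_left.1 hUV hyU (subset_closure hy)
  let 𝒞 : Set (Set Y) := {C | C.Nontrivial ∧ ∃ x ∈ Uᶜ, C = connectedComponentIn Uᶜ x}
  have h𝒞 : 𝒞.Countable := hY.countable_components hK
  have hmeagre : IsMeagre (⋃ C ∈ 𝒞, C) := by
    have := h𝒞.to_subtype
    rw [biUnion_eq_iUnion]
    refine isMeagre_iUnion ?_
    rintro ⟨_, -, x, hx, rfl⟩
    have hC := isSubcontinuum_connectedComponentIn hK hx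
    -- A component with interior would decompose `Y`; it is proper because it misses `a`.
    refine IsNowhereDense.isMeagre ?_
    rw [hC.isCompact.isClosed.isNowhereDense_iff]
    by_contra hne
    refine hdec (isDecomposable_univ_of_interior_nonempty hC (fun h => ?_)
      (nonempty_iff_ne_empty.2 hne))
    exact connectedComponentIn_subset Uᶜ x (h ▸ mem_univ a : a ∈ connectedComponentIn Uᶜ x) haU
  have hVsub : V ⊆ ⋃ C ∈ 𝒞, C := fun y hy => mem_iUnion₂.2
    ⟨connectedComponentIn Uᶜ y, ⟨connectedComponentIn_nontrivial_of_ne_univ hK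
      isClosed_closure.isOpen_compl hWK hWne (hVW hy), y, hWK (hVW hy), rfl⟩,
      mem_connectedComponentIn (hWK (hVW hy))⟩
  exact not_isMeagre_of_isOpen hV ⟨b, hbV⟩ (hmeagre.mono hVsub)

theorem IsSubcontinuum.connectedSpace {C : Set Y} (hC : IsSubcontinuum C) : ConnectedSpace C :=
  isConnected_iff_connectedSpace.1 hC.isConnected

theorem IsSubcontinuum.compactSpace {C : Set Y} (hC : IsSubcontinuum C) : CompactSpace C :=
  isCompact_iff_compactSpace.1 hC.isCompact

theorem IsDecomposable.image {Z : Type u} [TopologicalSpace Z] {C : Set Y}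
    (hC : IsDecomposable C) {f : Y → Z} (hf : Continuous f) (hinj : Function.Injective f) :
    IsDecomposable (f '' C) := by
  obtain ⟨A, B, hA, hB, hAn, hBn, hAC, hBC, hAB⟩ := hC
  exact ⟨f '' A, f '' B, hA.image hf, hB.image hf, hAn.image hinj, hBn.image hinj,
    ((hinj.injOn (s := C)).image_ssubset_image_iff hAC.subset Subset.rfl).2 hAC,
    ((hinj.injOn (s := C)).image_ssubset_image_iff hBC.subset Subset.rfl).2 hBC,
    by rw [← image_union, hAB]⟩

/-- Non-degenerate subcontinua of a Hausdorff Suslinian space are decomposable. -/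
theorem IsSuslinian.isDecomposable [T2Space Y] (hY : IsSuslinian Y) {C : Set Y}
    (hC : IsSubcontinuum C) (hCn : C.Nontrivial) : IsDecomposable C := by
  have := hC.connectedSpace
  have := hC.compactSpace
  have : Nontrivial C := hCn.coe_sort
  have h := (hY.of_injective (continuous_subtype_val (p := (· ∈ C)))
    Subtype.val_injective).isDecomposable_univ
  simpa using h.image continuous_subtype_val Subtype.val_injective

/-! ### Metrizability of zero-dimensional compacta -/

theorem exists_isSubcontinuum_nontrivial_disjoint [CompactSpace Y] [T2Space Y] [ConnectedSpace Y]
    [Nontrivial Y] {Z : Set Y} (hZ : IsClosed Z) (hne : Z ≠ Set.univ) :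
    ∃ C : Set Y, IsSubcontinuum C ∧ C.Nontrivial ∧ Disjoint C Z := by
  obtain ⟨y, hy⟩ := (ne_univ_iff_exists_notMem Z).1 hne
  obtain ⟨K, hyK, hK, hKZ⟩ := exists_mem_nhds_isClosed_subset (hZ.isOpen_compl.mem_nhds hy)
  have hyU : y ∈ interior K := mem_interior_iff_mem_nhds.2 hyK
  by_cases hU : interior K = Set.univ
  · refine ⟨Set.univ, ⟨isCompact_univ, isConnected_univ⟩, nontrivial_univ, ?_⟩
    rw [← subset_compl_iff_disjoint_right, ← hU]
    exact interior_subset.trans hKZ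
  · exact ⟨connectedComponentIn K y, isSubcontinuum_connectedComponentIn hK (interior_subset hyU),
      connectedComponentIn_nontrivial_of_ne_univ hK isOpen_interior interior_subset hU hyU,
      subset_compl_iff_disjoint_right.1 ((connectedComponentIn_subset K y).trans hKZ)⟩

/-- A maximal disjoint family of non-degenerate subcontinua missing `Z`. -/
theorem exists_maximal_isDisjointContinuumFamily (Z : Set Y) :
    ∃ 𝒞 : Set (Set Y), IsDisjointContinuumFamily 𝒞 ∧ (∀ C ∈ 𝒞, Disjoint C Z) ∧
      ∀ D : Set Y, IsSubcontinuum D → D.Nontrivial → Disjoint D Z → ∃ C ∈ 𝒞, (C ∩ D).Nonempty := by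
  obtain ⟨𝒞, ⟨h𝒞, h𝒞Z⟩, hmax⟩ := zorn_subset
    {𝒞 : Set (Set Y) | IsDisjointContinuumFamily 𝒞 ∧ ∀ C ∈ 𝒞, Disjoint C Z} (by
      intro c hc hchain
      refine ⟨⋃₀ c, ⟨⟨?_, ?_, ?_⟩, ?_⟩, fun s hs => subset_sUnion_of_mem hs⟩
      · rintro C ⟨s, hs, hCs⟩
        exact (hc hs).1.isSubcontinuum C hCs
      · rintro C ⟨s, hs, hCs⟩
        exact (hc hs).1.nontrivial C hCs
      · exact (pairwiseDisjoint_sUnion hchain.directedOn).2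
          fun s hs => (hc hs).1.pairwiseDisjoint
      · rintro C ⟨s, hs, hCs⟩
        exact (hc hs).2 C hCs)
  refine ⟨𝒞, h𝒞, h𝒞Z, fun D hD hDn hDZ => ?_⟩
  by_contra hcon
  push Not at hcon
  have hins : insert D 𝒞 ∈ {𝒞 : Set (Set Y) | IsDisjointContinuumFamily 𝒞 ∧
      ∀ C ∈ 𝒞, Disjoint C Z} := by
    refine ⟨⟨?_, ?_, ?_⟩, ?_⟩
    · rintro C (rfl | hC)
      exacts [hD, h𝒞.isSubcontinuum C hC]
    · rintro C (rfl | hC)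
      exacts [hDn, h𝒞.nontrivial C hC]
    · refine h𝒞.pairwiseDisjoint.insert fun C hC _ => ?_
      exact (disjoint_iff_inter_eq_empty.2 (hcon C hC)).symm
    · rintro C (rfl | hC)
      exacts [hDZ, h𝒞Z C hC]
  have hD𝒞 : D ∈ 𝒞 := hmax hins (subset_insert D 𝒞) (mem_insert D 𝒞)
  have := hcon D hD𝒞
  rw [inter_self] at this
  exact hDn.nonempty.ne_empty this

/-- A weighted sum of Urysohn functions, one for each member of the family. -/
theorem exists_continuous_zero_pos_of_countable [NormalSpace Y] {Z : Set Y} (hZ : IsClosed Z)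
    {𝒞 : Set (Set Y)} (h𝒞 : 𝒞.Countable) (hcl : ∀ C ∈ 𝒞, IsClosed C)
    (hdisj : ∀ C ∈ 𝒞, Disjoint C Z) :
    ∃ g : Y → ℝ, Continuous g ∧ (∀ y, 0 ≤ g y) ∧ (∀ y ∈ Z, g y = 0) ∧
      ∀ C ∈ 𝒞, ∀ y ∈ C, 0 < g y := by
  rcases 𝒞.eq_empty_or_nonempty with rfl | hne
  · exact ⟨0, continuous_const, by simp, by simp, by simp⟩
  obtain ⟨c, rfl⟩ := h𝒞.exists_eq_range hne
  have hex : ∀ n, ∃ f : C(Y, ℝ), EqOn f 0 Z ∧ EqOn f 1 (c n) ∧ ∀ x, f x ∈ Icc (0 : ℝ) 1 :=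
    fun n => exists_continuous_zero_one_of_isClosed hZ (hcl _ (mem_range_self n))
      (hdisj _ (mem_range_self n)).symm
  choose f hf0 hf1 hf using hex
  have hb : ∀ n y, ‖f n y * (1 / 2 / 2 ^ n)‖ ≤ 1 / 2 / 2 ^ n := fun n y => by
    simp [abs_of_nonneg (hf n y).1, (hf n y).2]
  have hs : ∀ y, Summable fun n => f n y * (1 / 2 / 2 ^ n) := fun y =>
    (summable_geometric_two' 1).of_norm_bounded fun n => hb n y
  have hnn : ∀ y n, 0 ≤ f n y * (1 / 2 / 2 ^ n) := fun y n =>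
    mul_nonneg (hf n y).1 (by positivity)
  refine ⟨fun y => ∑' n, f n y * (1 / 2 / 2 ^ n),
    continuous_tsum (fun n => (f n).continuous.mul continuous_const) (summable_geometric_two' 1) hb,
    fun y => tsum_nonneg (hnn y), fun y hy => ?_, ?_⟩
  · simp [fun n => hf0 n hy]
  · rintro _ ⟨n, rfl⟩ y hy
    refine (hs y).tsum_pos (hnn y) n ?_
    rw [hf1 n hy]
    simp

/-- A compact totally disconnected subset of a Suslinian continuum lies in the zero set of a
continuous function whose zero set is totally disconnected. -/
theorem IsSuslinian.exists_totallyDisconnected_zero_set [CompactSpace Y] [T2Space Y]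
    (hY : IsSuslinian Y) {Z : Set Y} (hZ : IsClosed Z) (hZd : IsTotallyDisconnected Z) :
    ∃ g : Y → ℝ, Continuous g ∧ (∀ y, 0 ≤ g y) ∧ (∀ y ∈ Z, g y = 0) ∧
      IsTotallyDisconnected {y | g y = 0} := by
  obtain ⟨𝒞, h𝒞, h𝒞Z, hmax⟩ := exists_maximal_isDisjointContinuumFamily Z
  obtain ⟨g, hg, hg0, hgZ, hgC⟩ := exists_continuous_zero_pos_of_countable hZ (hY 𝒞 h𝒞)
    (fun C hC => (h𝒞.isSubcontinuum C hC).isCompact.isClosed) h𝒞Z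
  refine ⟨g, hg, hg0, hgZ, fun P hP hPc => ?_⟩
  by_contra hPn
  rw [not_subsingleton_iff] at hPn
  have hPcl : closure P ⊆ {y | g y = 0} :=
    closure_minimal hP (isClosed_eq hg continuous_const)
  have hQ : IsSubcontinuum (closure P) :=
    ⟨isClosed_closure.isCompact, hPn.nonempty.closure, hPc.closure⟩
  have hQn : (closure P).Nontrivial := hPn.mono subset_closure
  have := hQ.connectedSpace
  have := hQ.compactSpace
  have : Nontrivial (closure P) := hQn.coe_sort
  -- `Z` cannot contain the continuum `closure P`, so a smaller continuum `D` avoids `Z`, and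
  -- maximality makes `D` meet the family, where `g > 0`.
  obtain ⟨D, hD, hDn, hDZ⟩ := exists_isSubcontinuum_nontrivial_disjoint
    (Z := ((↑) ⁻¹' Z : Set (closure P))) (hZ.preimage continuous_subtype_val) (fun h => by
      have hsub : closure P ⊆ Z := fun y hy => (h ▸ mem_univ (⟨y, hy⟩ : closure P) :
        (⟨y, hy⟩ : closure P) ∈ ((↑) ⁻¹' Z : Set (closure P)))
      exact hQn.not_subsingleton (hZd _ hsub hPc.closure))
  obtain ⟨C, hC, _, hyC, ⟨y, hy, rfl⟩⟩ := hmax ((↑) '' D) (hD.image continuous_subtype_val)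
    (hDn.image Subtype.val_injective) (by
      rw [disjoint_left]
      rintro _ ⟨y, hy, rfl⟩ hyZ
      exact disjoint_left.1 hDZ hy hyZ)
  exact (hgC C hC y hyC).ne' (hPcl y.2)

/-- Distinct points of a totally disconnected zero set are separated by non-degenerate components
of one of its neighbourhoods `{g ≤ 1 / (n + 1)}`. -/
theorem exists_disjoint_components [CompactSpace Y] [T2Space Y] [ConnectedSpace Y]
    {g : Y → ℝ} (hg : Continuous g) (hg0 : ∀ y, 0 ≤ g y)
    (hd : IsTotallyDisconnected {y | g y = 0}) {a b : Y} (ha : g a = 0) (hb : g b = 0)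
    (hab : a ≠ b) :
    ∃ n : ℕ, (connectedComponentIn {y | g y ≤ 1 / ((n : ℝ) + 1)} a).Nontrivial ∧
      (connectedComponentIn {y | g y ≤ 1 / ((n : ℝ) + 1)} b).Nontrivial ∧
      Disjoint (connectedComponentIn {y | g y ≤ 1 / ((n : ℝ) + 1)} a)
        (connectedComponentIn {y | g y ≤ 1 / ((n : ℝ) + 1)} b) := by
  let F : Set Y := {y | g y = 0}
  have hF : IsClosed F := isClosed_eq hg continuous_const
  have : CompactSpace F := isCompact_iff_compactSpace.1 hF.isCompact
  have : TotallyDisconnectedSpace F := totallyDisconnectedSpace_subtype_iff.2 hd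
  obtain ⟨Q, hQ, haQ, hbQ⟩ := exists_isClopen_of_totally_separated
    (show (⟨a, ha⟩ : F) ≠ ⟨b, hb⟩ from fun h => hab (congrArg Subtype.val h))
  obtain ⟨U, V, hU, hV, hQU, hQV, hUV⟩ := normal_separation
    (hF.isClosedMap_subtype_val _ hQ.isClosed) (hF.isClosedMap_subtype_val _ hQ.compl.isClosed)
    ((disjoint_image_iff Subtype.val_injective).2 disjoint_compl_right)
  have haU : a ∈ U := hQU ⟨⟨a, ha⟩, haQ, rfl⟩
  have hbV : b ∈ V := hQV ⟨⟨b, hb⟩, hbQ, rfl⟩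
  have hFUV : F ⊆ U ∪ V := fun y hy => by
    by_cases hyQ : (⟨y, hy⟩ : F) ∈ Q
    · exact Or.inl (hQU ⟨_, hyQ, rfl⟩)
    · exact Or.inr (hQV ⟨_, hyQ, rfl⟩)
  have hKcl : ∀ n : ℕ, IsClosed {y | g y ≤ 1 / ((n : ℝ) + 1)} := fun n =>
    isClosed_le hg continuous_const
  have hanti : Antitone fun n : ℕ => {y | g y ≤ 1 / ((n : ℝ) + 1)} := fun m n hmn y hy =>
    (show g y ≤ 1 / ((n : ℝ) + 1) from hy).trans (Nat.one_div_le_one_div hmn)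
  -- The compact sublevel sets decrease to `F ⊆ U ∪ V`, so one of them already lies in `U ∪ V`.
  obtain ⟨n, hn⟩ := exists_subset_nhds_of_isCompact hanti.directed_ge
    (fun n => (hKcl n).isCompact) (U := U ∪ V) (fun y hy => by
      refine (hU.union hV).mem_nhds (hFUV ?_)
      have hle : ∀ n : ℕ, g y ≤ 1 / ((n : ℝ) + 1) := mem_iInter.1 hy
      exact le_antisymm (ge_of_tendsto' tendsto_one_div_add_atTop_nhds_zero_nat hle) (hg0 y))
  set K : Set Y := {y | g y ≤ 1 / ((n : ℝ) + 1)}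
  have hpos : (0 : ℝ) < 1 / ((n : ℝ) + 1) := Nat.one_div_pos_of_nat
  have hWo : IsOpen {y | g y < 1 / ((n : ℝ) + 1)} := isOpen_lt hg continuous_const
  have hWK : {y | g y < 1 / ((n : ℝ) + 1)} ⊆ K := fun y (hy : g y < _) =>
    show g y ≤ _ from hy.le
  have haW : a ∈ {y | g y < 1 / ((n : ℝ) + 1)} := by simpa [ha] using hpos
  have hbW : b ∈ {y | g y < 1 / ((n : ℝ) + 1)} := by simpa [hb] using hpos
  have hCa : connectedComponentIn K a ⊆ U :=
    isPreconnected_connectedComponentIn.subset_left_of_subset_union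
    hU hV hUV ((connectedComponentIn_subset K a).trans hn)
    ⟨a, mem_connectedComponentIn (hWK haW), haU⟩
  have hCb : connectedComponentIn K b ⊆ V :=
    isPreconnected_connectedComponentIn.subset_right_of_subset_union
    hU hV hUV ((connectedComponentIn_subset K b).trans hn)
    ⟨b, mem_connectedComponentIn (hWK hbW), hbV⟩
  -- Otherwise `K` is all of `Y`, and the component of `a` contains `b`.
  have hWne : {y | g y < 1 / ((n : ℝ) + 1)} ≠ Set.univ := fun h => by
    have hb' : b ∈ connectedComponentIn K a := isPreconnected_univ.subset_connectedComponentIn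
      (mem_univ a) (h ▸ hWK) (mem_univ b)
    exact disjoint_left.1 hUV (hCa hb') hbV
  exact ⟨n, connectedComponentIn_nontrivial_of_ne_univ (hKcl n) hWo hWK hWne haW,
    connectedComponentIn_nontrivial_of_ne_univ (hKcl n) hWo hWK hWne hbW, hUV.mono hCa hCb⟩

/-- Urysohn functions of the countably many disjoint pairs inject `Z` into a countable power of `ℝ`;
compactness makes this an embedding. -/
theorem metrizableSpace_of_countable_separating_closed [NormalSpace Y] {Z : Set Y} [CompactSpace Z]
    {𝒟 : Set (Set Y)} (h𝒟 : 𝒟.Countable) (hcl : ∀ D ∈ 𝒟, IsClosed D)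
    (hsep : ∀ a ∈ Z, ∀ b ∈ Z, a ≠ b → ∃ A ∈ 𝒟, ∃ B ∈ 𝒟, a ∈ A ∧ b ∈ B ∧ Disjoint A B) :
    TopologicalSpace.MetrizableSpace Z := by
  let ι := {p : 𝒟 × 𝒟 // Disjoint p.1.1 p.2.1}
  have := h𝒟.to_subtype
  have hex : ∀ p : ι, ∃ f : C(Y, ℝ), EqOn f 0 p.1.1.1 ∧ EqOn f 1 p.1.2.1 ∧
      ∀ x, f x ∈ Icc (0 : ℝ) 1 := fun p =>
    exists_continuous_zero_one_of_isClosed (hcl _ p.1.1.2) (hcl _ p.1.2.2) p.2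
  choose f hf0 hf1 _ using hex
  have hcont : Continuous fun (z : Z) (p : ι) => f p z :=
    continuous_pi fun p => (f p).continuous.comp continuous_subtype_val
  have hinj : Function.Injective fun (z : Z) (p : ι) => f p z := by
    intro a b h
    by_contra hab
    obtain ⟨A, hA, B, hB, haA, hbB, hAB⟩ := hsep a a.2 b b.2 fun h' => hab (Subtype.ext h')
    have h1 := congrFun h (⟨(⟨A, hA⟩, ⟨B, hB⟩), hAB⟩ : ι)
    have h2 := hf0 (⟨(⟨A, hA⟩, ⟨B, hB⟩), hAB⟩ : ι) haA
    have h3 := hf1 (⟨(⟨A, hA⟩, ⟨B, hB⟩), hAB⟩ : ι) hbB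
    simp only at h1
    rw [h2, h3] at h1
    simp at h1
  exact (hcont.isClosedEmbedding hinj).isEmbedding.metrizableSpace

/-- Compact totally disconnected subsets of a Suslinian continuum are metrizable. -/
theorem IsSuslinian.metrizableSpace [CompactSpace Y] [T2Space Y] [ConnectedSpace Y]
    (hY : IsSuslinian Y) {Z : Set Y} (hZ : IsClosed Z) (hZd : IsTotallyDisconnected Z) :
    TopologicalSpace.MetrizableSpace Z := by
  obtain ⟨g, hg, hg0, hgZ, hd⟩ := hY.exists_totallyDisconnected_zero_set hZ hZd
  have := isCompact_iff_compactSpace.1 hZ.isCompact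
  have hKcl : ∀ n : ℕ, IsClosed {y | g y ≤ 1 / ((n : ℝ) + 1)} := fun n =>
    isClosed_le hg continuous_const
  refine metrizableSpace_of_countable_separating_closed
    (countable_iUnion fun n => hY.countable_components (hKcl n)) ?_ ?_
  · intro D hD
    obtain ⟨n, -, x, hx, rfl⟩ := mem_iUnion.1 hD
    exact (isSubcontinuum_connectedComponentIn (hKcl n) hx).isCompact.isClosed
  · intro a ha b hb hab
    obtain ⟨n, hna, hnb, hdisj⟩ := exists_disjoint_components hg hg0 hd (hgZ a ha) (hgZ b hb) hab
    have hmem : ∀ z ∈ Z, z ∈ {y | g y ≤ 1 / ((n : ℝ) + 1)} := fun z hz =>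
      (hgZ z hz).trans_le Nat.one_div_pos_of_nat.le
    exact ⟨_, mem_iUnion.2 ⟨n, hna, a, hmem a ha, rfl⟩, _,
      mem_iUnion.2 ⟨n, hnb, b, hmem b hb, rfl⟩, mem_connectedComponentIn (hmem a ha),
      mem_connectedComponentIn (hmem b hb), hdisj⟩

/-! ### From `Sln` to an ambient Suslinian continuum -/

theorem isSuslinian_of_continuumSln_le_aleph0 (h : continuumSln Y ≤ ℵ₀) : IsSuslinian Y :=
  fun 𝒞 h𝒞 => le_aleph0_iff_set_countable.1
    ((le_ciSup (f := fun 𝒞 : {𝒞 : Set (Set Y) // IsDisjointContinuumFamily 𝒞} => #𝒞.1)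
      Cardinal.bddAbove_of_small ⟨𝒞, h𝒞⟩).trans h)

/-- A Tychonoff space embeds in a continuum, namely a Tychonoff cube. -/
theorem exists_continuum_isEmbedding (X : Type u) [TopologicalSpace X] [T35Space X] :
    ∃ (Y : Type u) (_ : TopologicalSpace Y), CompactSpace Y ∧ T2Space Y ∧ ConnectedSpace Y ∧
      ∃ e : X → Y, IsEmbedding e := by
  let φ : StoneCech X → C(StoneCech X, unitInterval) → unitInterval := fun x f => f x
  have hφ : Continuous φ := continuous_pi fun f => f.continuous
  have hinj : Function.Injective φ := fun x y hxy => by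
    by_contra hne
    obtain ⟨f, hf, hfxy⟩ := separatesPoints_continuous_of_t35Space_Icc hne
    exact hfxy (congrFun hxy ⟨f, hf⟩)
  exact ⟨C(StoneCech X, unitInterval) → unitInterval, inferInstance, inferInstance, inferInstance,
    inferInstance, φ ∘ stoneCechUnit,
    (hφ.isClosedEmbedding hinj).isEmbedding.comp isEmbedding_stoneCechUnit⟩

theorem exists_isSuslinian_isEmbedding (X : Type u) [TopologicalSpace X] [T35Space X]
    (h : Sln X ≤ ℵ₀) :
    ∃ (Y : Type u) (_ : TopologicalSpace Y), CompactSpace Y ∧ T2Space Y ∧ ConnectedSpace Y ∧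
      IsSuslinian Y ∧ ∃ e : X → Y, IsEmbedding e := by
  -- Needed because `sInf ∅ = 0` would satisfy the bound vacuously.
  have hne : {κ : Cardinal.{u} | ∃ (Y : Type u) (_ : TopologicalSpace Y),
      CompactSpace Y ∧ T2Space Y ∧ ConnectedSpace Y ∧
      (∃ e : X → Y, IsEmbedding e) ∧ κ = continuumSln Y}.Nonempty := by
    obtain ⟨Y, tY, h1, h2, h3, h4⟩ := exists_continuum_isEmbedding X
    exact ⟨continuumSln Y, Y, tY, h1, h2, h3, h4, rfl⟩
  obtain ⟨Y, tY, h1, h2, h3, h4, h5⟩ := csInf_mem hne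
  exact ⟨Y, tY, h1, h2, h3, isSuslinian_of_continuumSln_le_aleph0 (h5 ▸ h), h4⟩

theorem totallyDisconnectedSpace_of_hasSmallInductiveDimensionLE_zero [T0Space Y]
    (h : HasSmallInductiveDimensionLE Y 0) : TotallyDisconnectedSpace Y :=
  have := totallySeparatedSpace_of_t0_of_basis_clopen (hasSmallInductiveDimensionLT_one_iff.1 h)
  inferInstance

end Continua

theorem mainTheorem10 :
    (∀ (X : Type u) [TopologicalSpace X] [T35Space X], Sln X ≤ ℵ₀ →
      (∀ Z : Set X, IsCompact Z → HasSmallInductiveDimensionLE Z 0 →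
        TopologicalSpace.MetrizableSpace Z) ∧
      (∀ C : Set X, IsSubcontinuum C → C.Nontrivial → IsDecomposable C)) ∧
    (∀ (X : Type u) [TopologicalSpace X] [CompactSpace X] [T2Space X] [ConnectedSpace X],
      IsSuslinian X → IsHereditarilyDecomposable X) := by
  refine ⟨fun X _ _ hX => ?_, fun X _ _ _ _ hX C hC hCn => hX.isDecomposable hC hCn⟩
  obtain ⟨Y, _, _, _, _, hY, e, he⟩ := exists_isSuslinian_isEmbedding X hX
  refine ⟨fun Z hZ hZ0 => ?_, fun C hC hCn =>
    (hY.of_injective he.continuous he.injective).isDecomposable hC hCn⟩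
  have hZd : IsTotallyDisconnected Z := totallyDisconnectedSpace_subtype_iff.1
    (totallyDisconnectedSpace_of_hasSmallInductiveDimensionLE_zero hZ0)
  have := hY.metrizableSpace (hZ.image he.continuous).isClosed
    (he.isTotallyDisconnected_image.2 hZd)
  exact (he.homeomorphImage Z).isEmbedding.metrizableSpace
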